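/- Let $\ell \ge 2$ and let $m_2, n_2, m_3, n_3, \dots, m_\ell, n_\ell \ge 1$ be integers. **Monoid.** In the free monoid on $a_1,\dots,a_\ell$ define words inductively by $w_1 = a_1$ and $w_i = w_{i-1}^{m_i} \cdots w_2^{m_3} w_1^{m_2} a_i$ for $2 \le i \le \ell$, and let $$M = \langle a_1,\dots,a_\ell \mid a_{i-1} = a_i w_i^{n_i}\ (2 \le i \le \ell)\rangle^+ .$$ Then $M$ is of $O$-type, that is, $M$ is left- and right-cancellative, $1$ is its only invertible element, and for all $g,h\in M$ one of $g, h$ is a left-divisor of the other and one of $g,h$ is a right-divisor of the other. Moreover $a_1^N$ is central in $M$ for every integer $N \ge 0$ such that $(m_2+1)\cdots(m_i+1)$ divides $N(n_2+1)\cdots(n_{i-1}+1)$ for each $i = 2,\dots,\ell$; in particular $a_1^{(m_2+1)\cdots(m_\ell+1)}$ is central in $M$. **Group.** Let $$G = \langle x_1,\dots,x_\ell \mid x_{i-1}^{m_i+1} = x_i^{n_i+1}\ (2\le i\le \ell)\rangle .$$ Then $G$ is left-orderable, and the subsemigroup of $G$ generated by the elements $x_1^{-m_2}x_2^{-m_3}\cdots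 x_{i-1}^{-m_i}x_i$, $1 \le i \le \ell$ (that is, by $x_1$, $x_1^{-m_2}x_2$, $\dots$, $x_1^{-m_2}\cdots x_{\ell-1}^{-m_\ell}x_\ell$), is the positive cone $\{g \in G \mid g > 1\}$ of a left-invariant linear ordering of $G$ which is an isolated point of the space $\mathrm{LO}(G)$ of all left-invariant linear orderings of $G$, topologized as a subspace of $\{0,1\}^{G\times G}$ with the product topology. -/

import Mathlib

/-- A monoid is *of O-type* if it is cancellative, `1` is its only invertible element, and any two
elements are comparable both for left-divisibility (`g ∣ h` means `h = g * c` for some `c`) and for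
right-divisibility. -/
structure IsOType (M : Type*) [Monoid M] : Prop where
  left_cancel : ∀ h g g' : M, h * g = h * g' → g = g'
  right_cancel : ∀ h g g' : M, g * h = g' * h → g = g'
  eq_one_of_isUnit : ∀ g : M, IsUnit g → g = 1
  left_total : ∀ g h : M, (∃ c, g * c = h) ∨ (∃ c, h * c = g)
  right_total : ∀ g h : M, (∃ c, c * g = h) ∨ (∃ c, c * h = g)

/-- A left-invariant (strict, linear) ordering on the group `G`, that is, a point of `LO(G)`. -/
@[ext]
structure LeftOrdering (G : Type*) [Group G] where
  lt : G → G → Prop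
  irrefl : ∀ g, ¬ lt g g
  trans : ∀ f g h, lt f g → lt g h → lt f h
  total : ∀ g h, lt g h ∨ g = h ∨ lt h g
  mul_left : ∀ h g g', lt g g' → lt (h * g) (h * g')

namespace LeftOrdering

/-- The positive cone `{g | 1 < g}` of a left-invariant ordering. -/
def positiveCone {G : Type*} [Group G] (r : LeftOrdering G) : Set G := {g | r.lt 1 g}

open Classical in
/-- The topology of `LO(G)`: an ordering is viewed as a subset of `G × G`, and subsets of `G × G`
carry the product topology of `{0, 1} ^ (G × G)` (with `{0, 1} = Bool` discrete). -/
noncomputable instance {G : Type*} [Group G] : TopologicalSpace (LeftOrdering G) :=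
  TopologicalSpace.induced (fun r (p : G × G) => decide (r.lt p.1 p.2)) (inferInstance :
    TopologicalSpace (G × G → Bool))

/-- `r` is an isolated point of the space `LO(G)`. -/
def IsIsolated {G : Type*} [Group G] (r : LeftOrdering G) : Prop :=
  IsOpen ({r} : Set (LeftOrdering G))

end LeftOrdering

/- In what follows `ℓ = k + 1`. The generators with indices `1, …, ℓ` are indexed by
`0, …, k : Fin (k + 1)`, and the exponents `m_2, n_2, …, m_ℓ, n_ℓ` by `Fin k`:  `m j` and `n j`
(`j = 0, …, k - 1`) are the exponents relating the consecutive generators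
`j.castSucc` and `j.succ`. -/

namespace TriangularMonoid

open FreeMonoid in
/-- The word `w_{i-1}^{m_i} ⋯ w_2^{m_3} w_1^{m_2}` that precedes the last letter of `w_i`.
It is empty for the first index, and the next one is obtained by putting
`(w_{i-1})^{m_i}` in front, where `w_{i-1}` is the previous prefix followed by the letter
`a_{i-1}`. -/
def wordPrefix {k : ℕ} (m : Fin k → ℕ) (i : Fin (k + 1)) : FreeMonoid (Fin (k + 1)) :=
  Fin.induction (motive := fun _ => FreeMonoid (Fin (k + 1))) 1
    (fun j P => (P * of j.castSucc) ^ m j * P) i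

/-- The words `w_1 = a_1` and `w_i = w_{i-1}^{m_i} ⋯ w_2^{m_3} w_1^{m_2} a_i`. -/
def word {k : ℕ} (m : Fin k → ℕ) (i : Fin (k + 1)) : FreeMonoid (Fin (k + 1)) :=
  wordPrefix m i * FreeMonoid.of i

/-- The relations `a_{i-1} = a_i w_i^{n_i}`. -/
def rels {k : ℕ} (m n : Fin k → ℕ) (u v : FreeMonoid (Fin (k + 1))) : Prop :=
  ∃ j : Fin k, u = FreeMonoid.of j.castSucc ∧ v = FreeMonoid.of j.succ * word m j.succ ^ n j

end TriangularMonoid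

/-- The monoid `⟨a_1, …, a_ℓ | a_{i-1} = a_i w_i^{n_i} (2 ≤ i ≤ ℓ)⟩⁺`. -/
abbrev TriangularMonoid {k : ℕ} (m n : Fin k → ℕ) : Type :=
  PresentedMonoid (TriangularMonoid.rels m n)

/-- The group `⟨x_1, …, x_ℓ | x_{i-1}^{m_i + 1} = x_i^{n_i + 1} (2 ≤ i ≤ ℓ)⟩`. -/
abbrev TorusAmalgam {k : ℕ} (m n : Fin k → ℕ) : Type :=
  PresentedGroup (Set.range fun j : Fin k =>
    FreeGroup.of j.castSucc ^ (m j + 1) * (FreeGroup.of j.succ ^ (n j + 1))⁻¹)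

namespace TorusAmalgam

/-- The generators `x_1, …, x_ℓ`. -/
def x {k : ℕ} (m n : Fin k → ℕ) (i : Fin (k + 1)) : TorusAmalgam m n := PresentedGroup.of i

/-- The elements `x_1^{-m_2} x_2^{-m_3} ⋯ x_{i-1}^{-m_i} x_i`, equal to `x_1` for the first index.
(`Fin.partialProd f i` is the product of the first `i` entries of `f`, in increasing order.) -/
def coneGen {k : ℕ} (m n : Fin k → ℕ) (i : Fin (k + 1)) : TorusAmalgam m n :=
  Fin.partialProd (fun j : Fin k => (x m n j.castSucc ^ m j)⁻¹) i * x m n i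

end TorusAmalgam

/-!
In a presentation whose relations `a = b C` rewrite each letter `a` in at most one way, and always
so that the first letter gets larger, two words are equal if and only if they can be matched from
left to right by expanding, whenever their first letters differ, the smaller of the two. Left
cancellation is immediate from this description, and two elements with a common right multiple are
comparable for left divisibility. Since `a (P a) ^ n = (a P) ^ n a`, the relations of the triangular
monoid have this shape both from the left and from the right.

The `w_i` satisfy `w_{i-1} ^ (m_i + 1) = w_i ^ (n_i + 1)` and generate the monoid up to left
division. Hence a power of `a_1 = w_1` that is a power of every `w_i` is central; every letter
divides it, so all elements have common multiples. Sending `w_i` to `x_i` identifies the monoid of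
O-type so obtained with a submonoid of the group `G`, and its nontrivial elements form a finitely
generated positive cone. An ordering with such a cone is isolated, because it is determined by the
positivity of the generators.
-/

/-! ### Triangular presentations -/

/-- A (right-)triangular system of relations `a = b C`, indexed by `j : ι` with `a = source j`,
`b = target j`, `C = tail j`: every letter is rewritten by at most one relation, into a word that
starts with a larger letter. -/
structure TriangularSystem (α ι : Type*) [LinearOrder α] where
  source : ι → α
  target : ι → α
  tail : ι → List α
  source_injective : Function.Injective source
  source_lt_target : ∀ j, source j < target j

namespace TriangularSystem

variable {α ι : Type*} [LinearOrder α] (R : TriangularSystem α ι)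

/-- The relations of a triangular system, in the form expected by `PresentedMonoid`. -/
def rel (u v : FreeMonoid α) : Prop :=
  ∃ j, u = .of (R.source j) ∧ v = .of (R.target j) * .ofList (R.tail j)

/-- Two words are aligned if they become equal by repeatedly removing a common first letter and,
where the first letters differ, expanding the smaller one. This is a cut-free form of the congruence
generated by the relations: no transitivity is built in. -/
inductive Aligned : List α → List α → Prop
  | nil : Aligned [] []
  | cons (a : α) {U V : List α} : Aligned U V → Aligned (a :: U) (a :: V)
  | expand_left (j : ι) {t : α} {U V : List α} : R.source j < t →
      Aligned (R.target j :: (R.tail j ++ U)) (t :: V) → Aligned (R.source j :: U) (t :: V)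
  | expand_right (j : ι) {t : α} {U V : List α} : R.source j < t →
      Aligned (t :: U) (R.target j :: (R.tail j ++ V)) → Aligned (t :: U) (R.source j :: V)

variable {R}

namespace Aligned

variable {U V W : List α}

lemma refl : ∀ U : List α, R.Aligned U U
  | [] => .nil
  | a :: U => .cons a (refl U)

lemma append_left (h : R.Aligned U V) : ∀ S : List α, R.Aligned (S ++ U) (S ++ V)
  | [] => h
  | a :: S => .cons a (h.append_left S)

lemma of_cons {a : α} (h : R.Aligned (a :: U) (a :: V)) : R.Aligned U V := by
  cases h with
  | cons _ h => exact h
  | expand_left j hlt _ => exact absurd hlt (lt_irrefl _)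
  | expand_right j hlt _ => exact absurd hlt (lt_irrefl _)

lemma of_append_left : ∀ S : List α, R.Aligned (S ++ U) (S ++ V) → R.Aligned U V
  | [], h => h
  | _ :: S, h => of_append_left S h.of_cons

lemma expand_head {j : ι} (h : R.Aligned (R.source j :: U) V) :
    R.Aligned (R.target j :: (R.tail j ++ U)) V := by
  generalize hX : R.source j :: U = X at h
  induction h with
  | nil => cases hX
  | cons a h =>
    obtain ⟨rfl, rfl⟩ := List.cons_eq_cons.1 hX
    exact .expand_right j (R.source_lt_target j) ((h.append_left _).cons _)
  | expand_left i _ h =>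
    obtain ⟨hij, rfl⟩ := List.cons_eq_cons.1 hX
    rwa [R.source_injective hij]
  | expand_right i hlt _ ih =>
    obtain ⟨rfl, rfl⟩ := List.cons_eq_cons.1 hX
    exact .expand_right i (hlt.trans (R.source_lt_target j)) (ih rfl)

lemma contract_head {j : ι} (h : R.Aligned (R.target j :: (R.tail j ++ U)) V) :
    R.Aligned (R.source j :: U) V := by
  generalize hX : R.target j :: (R.tail j ++ U) = X at h
  induction h with
  | nil => cases hX
  | cons a h =>
    obtain ⟨rfl, rfl⟩ := List.cons_eq_cons.1 hX
    exact .expand_left j (R.source_lt_target j) (h.cons _)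
  | expand_left i hlt h =>
    obtain ⟨hi, rfl⟩ := List.cons_eq_cons.1 hX
    exact .expand_left j ((R.source_lt_target j).trans (hi ▸ hlt)) (hi ▸ h.expand_left i hlt)
  | expand_right i hlt h ih =>
    obtain ⟨rfl, rfl⟩ := List.cons_eq_cons.1 hX
    rcases lt_trichotomy (R.source i) (R.source j) with hij | hij | hji
    · exact .expand_right i hij (ih rfl)
    · obtain rfl := R.source_injective hij
      exact (of_append_left _ h.of_cons).cons _
    · exact .expand_left j hji (h.expand_right i hlt)

lemma replace_suffix (hUV : ∀ X, R.Aligned U X → R.Aligned V X) {S : List α}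
    (h : R.Aligned (S ++ U) W) : R.Aligned (S ++ V) W := by
  generalize hX : S ++ U = X at h
  induction h generalizing S with
  | nil =>
    obtain ⟨rfl, rfl⟩ := List.append_eq_nil_iff.1 hX
    exact hUV _ .nil
  | cons a h ih =>
    rcases S with - | ⟨b, S⟩
    · obtain rfl : U = _ := hX
      exact hUV _ (h.cons a)
    · obtain ⟨rfl, rfl⟩ := List.cons_eq_cons.1 hX
      exact (ih rfl).cons b
  | expand_left j hlt h ih =>
    rcases S with - | ⟨b, S⟩
    · obtain rfl : U = _ := hX
      exact hUV _ (h.expand_left j hlt)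
    · obtain ⟨rfl, rfl⟩ := List.cons_eq_cons.1 hX
      refine .expand_left j hlt ?_
      simpa using ih (S := R.target j :: (R.tail j ++ S)) (by simp)
  | expand_right j hlt h ih =>
    rcases S with - | ⟨b, S⟩
    · obtain rfl : U = _ := hX
      exact hUV _ (h.expand_right j hlt)
    · obtain ⟨rfl, rfl⟩ := List.cons_eq_cons.1 hX
      exact .expand_right j hlt (ih (S := b :: S) rfl)

end Aligned

lemma aligned_congr_of_conGen {u v : FreeMonoid α} (h : conGen R.rel u v) (S T W : List α) :
    R.Aligned (S ++ (u.toList ++ T)) W ↔ R.Aligned (S ++ (v.toList ++ T)) W := by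
  induction h generalizing S T with
  | of u v h =>
    obtain ⟨j, rfl, rfl⟩ := h
    exact ⟨Aligned.replace_suffix fun X h => by simpa using h.expand_head,
      Aligned.replace_suffix fun X h => .contract_head (by simpa using h)⟩
  | refl u => rfl
  | symm _ ih => exact (ih S T).symm
  | trans _ _ ih ih' => exact (ih S T).trans (ih' S T)
  | @mul u u' v v' _ _ ih ih' =>
    simpa using (ih S (v.toList ++ T)).trans (by simpa using ih' (S ++ u'.toList) T)

/-- The monoid `M` is presented by the system `R`, its letters being interpreted through `π`. -/
structure Presents (R : TriangularSystem α ι) {M : Type*} [Monoid M] (π : FreeMonoid α →* M) :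
    Prop where
  surjective : Function.Surjective π
  ker_eq : Con.ker π = conGen R.rel

namespace Presents

variable {M : Type*} [Monoid M] {π : FreeMonoid α →* M}

lemma map_source (hπ : R.Presents π) (j : ι) :
    π (.of (R.source j)) = π (.of (R.target j)) * π (.ofList (R.tail j)) := by
  rw [← map_mul, ← Con.ker_apply, hπ.ker_eq]
  exact .of _ _ ⟨j, rfl, rfl⟩

lemma map_eq_of_aligned (hπ : R.Presents π) {U V : List α} (h : R.Aligned U V) :
    π (.ofList U) = π (.ofList V) := by
  induction h with
  | nil => rfl
  | cons a _ ih => simp only [FreeMonoid.ofList_cons, map_mul, ih]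
  | expand_left j _ _ ih | expand_right j _ _ ih =>
    simpa only [FreeMonoid.ofList_cons, FreeMonoid.ofList_append, map_mul, hπ.map_source,
      mul_assoc] using ih

lemma map_eq_map_iff (hπ : R.Presents π) {u v : FreeMonoid α} :
    π u = π v ↔ R.Aligned u.toList v.toList := by
  refine ⟨fun h => ?_, hπ.map_eq_of_aligned⟩
  rw [← Con.ker_apply, hπ.ker_eq] at h
  simpa using (aligned_congr_of_conGen h [] [] v.toList).2 (by simpa using .refl _)

lemma isLeftCancelMul (hπ : R.Presents π) : IsLeftCancelMul M where
  mul_left_cancel g g' h e := by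
    obtain ⟨u, rfl⟩ := hπ.surjective g
    obtain ⟨v, rfl⟩ := hπ.surjective g'
    obtain ⟨w, rfl⟩ := hπ.surjective h
    simp only [← map_mul] at e
    exact hπ.map_eq_map_iff.2 (.of_append_left u.toList (hπ.map_eq_map_iff.1 e))

lemma map_eq_one_iff (hπ : R.Presents π) {u : FreeMonoid α} : π u = 1 ↔ u = 1 := by
  refine ⟨fun h => ?_, fun h => by rw [h, map_one]⟩
  rw [← map_one π, hπ.map_eq_map_iff] at h
  generalize hU : u.toList = U at h
  cases h
  exact hU

lemma eq_one_of_isUnit (hπ : R.Presents π) {g : M} (hg : IsUnit g) : g = 1 := by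
  obtain ⟨h, hgh⟩ := hg.exists_right_inv
  obtain ⟨u, rfl⟩ := hπ.surjective g
  obtain ⟨v, rfl⟩ := hπ.surjective h
  rw [← map_mul, hπ.map_eq_one_iff] at hgh
  rw [show u = 1 from (List.append_eq_nil_iff.1 hgh).1, map_one]

lemma dvd_or_dvd_of_aligned (hπ : R.Presents π) {U V U' V' : List α}
    (h : R.Aligned (U ++ U') (V ++ V')) :
    π (.ofList U) ∣ π (.ofList V) ∨ π (.ofList V) ∣ π (.ofList U) := by
  generalize hX : U ++ U' = X, hY : V ++ V' = Y at h
  induction h generalizing U V with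
  | nil =>
    obtain ⟨rfl, -⟩ := List.append_eq_nil_iff.1 hX
    exact .inl (by simp)
  | cons a _ ih =>
    rcases U with - | ⟨b, U⟩
    · exact .inl (by simp)
    rcases V with - | ⟨c, V⟩
    · exact .inr (by simp)
    obtain ⟨rfl, rfl⟩ := List.cons_eq_cons.1 hX
    obtain ⟨rfl, rfl⟩ := List.cons_eq_cons.1 hY
    simp only [FreeMonoid.ofList_cons, map_mul]
    exact (ih rfl rfl).imp (mul_dvd_mul_left _) (mul_dvd_mul_left _)
  | expand_left j _ _ ih =>
    rcases U with - | ⟨b, U⟩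
    · exact .inl (by simp)
    obtain ⟨rfl, rfl⟩ := List.cons_eq_cons.1 hX
    simpa only [FreeMonoid.ofList_cons, FreeMonoid.ofList_append, map_mul, hπ.map_source,
      mul_assoc] using ih (U := R.target j :: (R.tail j ++ U)) (by simp) hY
  | expand_right j _ _ ih =>
    rcases V with - | ⟨c, V⟩
    · exact .inr (by simp)
    obtain ⟨rfl, rfl⟩ := List.cons_eq_cons.1 hY
    simpa only [FreeMonoid.ofList_cons, FreeMonoid.ofList_append, map_mul, hπ.map_source,
      mul_assoc] using ih (V := R.target j :: (R.tail j ++ V)) hX (by simp)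

lemma dvd_or_dvd_of_dvd_of_dvd (hπ : R.Presents π) {g h x : M} (hg : g ∣ x) (hh : h ∣ x) :
    g ∣ h ∨ h ∣ g := by
  obtain ⟨g', rfl⟩ := hg
  obtain ⟨h', e⟩ := hh
  obtain ⟨u, rfl⟩ := hπ.surjective g
  obtain ⟨u', rfl⟩ := hπ.surjective g'
  obtain ⟨v, rfl⟩ := hπ.surjective h
  obtain ⟨v', rfl⟩ := hπ.surjective h'
  simp only [← map_mul] at e
  exact hπ.dvd_or_dvd_of_aligned (U := u.toList) (V := v.toList) (hπ.map_eq_map_iff.1 e)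

lemma closure_range_of (hπ : R.Presents π) :
    Submonoid.closure (Set.range fun a => π (.of a)) = ⊤ := by
  rw [Set.range_comp' π, ← MonoidHom.map_mclosure, FreeMonoid.closure_range_of,
    ← MonoidHom.mrange_eq_map, MonoidHom.mrange_eq_top.2 hπ.surjective]

end Presents

end TriangularSystem

/-! ### Opposite presentations and central common multiples -/

lemma conGen_reverse {α : Type*} (r : FreeMonoid α → FreeMonoid α → Prop) (u v : FreeMonoid α) :
    conGen (fun u v => r u.reverse v.reverse) u v ↔ conGen r u.reverse v.reverse := by
  have reverse_of {r : FreeMonoid α → FreeMonoid α → Prop} {u v : FreeMonoid α}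
      (h : conGen (fun u v => r u.reverse v.reverse) u v) : conGen r u.reverse v.reverse := by
    induction h with
    | of u v h => exact .of _ _ h
    | refl u => exact .refl _
    | symm _ ih => exact .symm ih
    | trans _ _ ih ih' => exact .trans ih ih'
    | mul _ _ ih ih' => simpa only [FreeMonoid.reverse_mul] using .mul ih' ih
  refine ⟨reverse_of, fun h => ?_⟩
  rw [← u.reverse_reverse, ← v.reverse_reverse]
  exact reverse_of (by simpa only [FreeMonoid.reverse_reverse] using h)

/-- The opposite of the monoid presented by `r`, viewed as a quotient of the free monoid: words are
read from right to left. -/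
def mkOp {α : Type*} (r : FreeMonoid α → FreeMonoid α → Prop) :
    FreeMonoid α →* (PresentedMonoid r)ᵐᵒᵖ where
  toFun u := .op (.mk r u.reverse)
  map_one' := rfl
  map_mul' u v := by rw [FreeMonoid.reverse_mul, map_mul, MulOpposite.op_mul]

lemma exists_dvd_pow {M : Type*} [Monoid M] {z : M} (hz : ∀ g, Commute z g) {S : Set M}
    (hS : Submonoid.closure S = ⊤) (hSz : ∀ s ∈ S, s ∣ z) (g : M) : ∃ N, g ∣ z ^ N := by
  have hg : g ∈ Submonoid.closure S := hS ▸ Submonoid.mem_top g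
  induction hg using Submonoid.closure_induction with
  | mem s hs => exact ⟨1, by simpa using hSz s hs⟩
  | one => exact ⟨0, one_dvd _⟩
  | mul g h _ _ ihg ihh =>
    obtain ⟨N, c, hc⟩ := ihg
    obtain ⟨K, d, hd⟩ := ihh
    refine ⟨N + K, d * c, ?_⟩
    calc z ^ (N + K) = g * c * z ^ K := by rw [pow_add, hc]
      _ = g * (z ^ K * c) := by rw [mul_assoc, ((hz c).pow_left K).eq]
      _ = g * h * (d * c) := by rw [hd]; simp only [mul_assoc]

namespace TriangularSystem

variable {α ι : Type*} [LinearOrder α] {R : TriangularSystem α ι}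

lemma presents_mk (R : TriangularSystem α ι) : R.Presents (PresentedMonoid.mk R.rel) where
  surjective := PresentedMonoid.surjective_mk
  ker_eq := Con.ext fun _ _ => PresentedMonoid.mk_eq_mk_iff

lemma presents_mkOp {r : FreeMonoid α → FreeMonoid α → Prop}
    (hr : R.rel = fun u v => r u.reverse v.reverse) : R.Presents (mkOp r) where
  surjective g := by
    obtain ⟨u, hu⟩ := PresentedMonoid.surjective_mk g.unop
    refine ⟨u.reverse, MulOpposite.unop_injective ?_⟩
    rw [← hu]
    exact congrArg (PresentedMonoid.mk r) u.reverse_reverse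
  ker_eq := by
    ext u v
    rw [Con.ker_apply, hr, conGen_reverse, ← PresentedMonoid.mk_eq_mk_iff]
    exact MulOpposite.op_injective.eq_iff

namespace Presents

variable {M : Type*} [Monoid M] {π : FreeMonoid α →* M}

lemma dvd_or_dvd_of_commute (hπ : R.Presents π) {z : M} (hz : ∀ g, Commute z g)
    (hdvd : ∀ a, π (.of a) ∣ z) (g h : M) : g ∣ h ∨ h ∣ g := by
  obtain ⟨N, hN⟩ := exists_dvd_pow hz hπ.closure_range_of (Set.forall_mem_range.2 hdvd) g
  obtain ⟨K, hK⟩ := exists_dvd_pow hz hπ.closure_range_of (Set.forall_mem_range.2 hdvd) h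
  exact hπ.dvd_or_dvd_of_dvd_of_dvd (hN.trans (pow_dvd_pow z (le_max_left N K)))
    (hK.trans (pow_dvd_pow z (le_max_right N K)))

lemma isOType (hπ : R.Presents π) {κ : Type*} {L : TriangularSystem α κ} {ρ : FreeMonoid α →* Mᵐᵒᵖ}
    (hρ : L.Presents ρ) {z : M} (hz : ∀ g, Commute z g) (hπz : ∀ a, π (.of a) ∣ z)
    (hρz : ∀ a, ρ (.of a) ∣ .op z) : IsOType M where
  left_cancel h _ _ e := hπ.isLeftCancelMul.mul_left_cancel h e
  right_cancel h _ _ e := MulOpposite.op_injective <|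
    hρ.isLeftCancelMul.mul_left_cancel (.op h) (congrArg MulOpposite.op e)
  eq_one_of_isUnit _ hg := hπ.eq_one_of_isUnit hg
  left_total g h :=
    (hπ.dvd_or_dvd_of_commute hz hπz g h).imp (fun ⟨c, hc⟩ => ⟨c, hc.symm⟩)
      (fun ⟨c, hc⟩ => ⟨c, hc.symm⟩)
  right_total g h :=
    (hρ.dvd_or_dvd_of_commute (fun g => (hz g.unop).op) hρz (.op g) (.op h)).imp
      (fun ⟨c, hc⟩ => ⟨c.unop, congrArg MulOpposite.unop hc.symm⟩)
      (fun ⟨c, hc⟩ => ⟨c.unop, congrArg MulOpposite.unop hc.symm⟩)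

end Presents

/-- The triangular system of relations `a_j = a_{j + 1} C_j` on the letters `a_0, …, a_k`. -/
def ofFin {k : ℕ} (C : Fin k → List (Fin (k + 1))) : TriangularSystem (Fin (k + 1)) (Fin k) where
  source := Fin.castSucc
  target := Fin.succ
  tail := C
  source_injective := Fin.castSucc_injective k
  source_lt_target _ := Fin.castSucc_lt_succ

lemma Presents.of_dvd_of_zero {k : ℕ} {C : Fin k → List (Fin (k + 1))} {M : Type*} [Monoid M]
    {π : FreeMonoid (Fin (k + 1)) →* M} (hπ : (ofFin C).Presents π) (i : Fin (k + 1)) :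
    π (.of i) ∣ π (.of 0) := by
  induction i using Fin.induction with
  | zero => rfl
  | succ j ih => exact (Dvd.intro _ (hπ.map_source j).symm).trans ih

end TriangularSystem

/-! ### The triangular monoid -/

namespace TriangularMonoid

open FreeMonoid

variable {k : ℕ} (m n : Fin k → ℕ)

lemma wordPrefix_zero : wordPrefix m 0 = 1 := rfl

lemma wordPrefix_succ (j : Fin k) :
    wordPrefix m j.succ = word m j.castSucc ^ m j * wordPrefix m j.castSucc :=
  rfl

lemma presents_mk :
    (TriangularSystem.ofFin fun j => (word m j.succ ^ n j).toList).Presents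
      (PresentedMonoid.mk (rels m n)) :=
  TriangularSystem.presents_mk _

lemma presents_mkOp :
    (TriangularSystem.ofFin fun j =>
      ((of j.succ * wordPrefix m j.succ) ^ n j).reverse.toList).Presents (mkOp (rels m n)) := by
  refine TriangularSystem.presents_mkOp (funext₂ fun u v => propext <| exists_congr fun j => ?_)
  have reverse_eq_iff {u v : FreeMonoid (Fin (k + 1))} : u = v.reverse ↔ u.reverse = v :=
    List.reverse_eq_iff.symm
  have of_mul_word_pow : of j.succ * word m j.succ ^ n j
      = (of j.succ * wordPrefix m j.succ) ^ n j * of j.succ := (mul_pow_mul _ _ _).symm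
  rw [of_mul_word_pow, ← reverse_eq_iff, ← reverse_eq_iff, reverse_mul, reverse_of, reverse_of]
  rfl

/-- The element of the monoid represented by the word `w_i`. -/
def w (i : Fin (k + 1)) : TriangularMonoid m n := .mk (rels m n) (word m i)

lemma w_zero : w m n 0 = .of (rels m n) 0 := rfl

lemma w_eq (i : Fin (k + 1)) :
    w m n i = .mk (rels m n) (wordPrefix m i) * .of (rels m n) i :=
  map_mul _ _ _

lemma of_castSucc (j : Fin k) : PresentedMonoid.of (rels m n) j.castSucc
    = .of (rels m n) j.succ * w m n j.succ ^ n j := by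
  rw [w, ← map_pow, PresentedMonoid.of, PresentedMonoid.of, ← map_mul]
  exact PresentedMonoid.mk_eq_mk_of_rel ⟨j, rfl, rfl⟩

lemma w_pow (j : Fin k) : w m n j.castSucc ^ (m j + 1) = w m n j.succ ^ (n j + 1) := by
  calc w m n j.castSucc ^ (m j + 1)
      = w m n j.castSucc ^ m j * .mk _ (wordPrefix m j.castSucc)
          * (.of _ j.succ * w m n j.succ ^ n j) := by
        rw [pow_succ, w_eq _ _ j.castSucc, of_castSucc, mul_assoc]
    _ = .mk _ (wordPrefix m j.succ) * .of _ j.succ * w m n j.succ ^ n j := by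
        rw [wordPrefix_succ, map_mul, map_pow, w, mul_assoc _ _ (w m n j.succ ^ n j)]
    _ = w m n j.succ ^ (n j + 1) := by rw [← w_eq, pow_succ']

lemma eq_top_of_w_mem {S : Submonoid (TriangularMonoid m n)} (hw : ∀ i, w m n i ∈ S)
    (hS : ∀ g h, g ∈ S → g * h ∈ S → h ∈ S) : S = ⊤ := by
  have prefix_mem (i : Fin (k + 1)) : .mk (rels m n) (wordPrefix m i) ∈ S := by
    induction i using Fin.induction with
    | zero => exact S.one_mem
    | succ j ih =>
      rw [wordPrefix_succ, map_mul, map_pow]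
      exact S.mul_mem (S.pow_mem (hw j.castSucc) _) ih
  rw [eq_top_iff, ← PresentedMonoid.closure_range_of, Submonoid.closure_le, Set.range_subset_iff]
  exact fun i => hS _ _ (prefix_mem i) (w_eq m n i ▸ hw i)

lemma hom_ext_w {N : Type*} [Monoid N] [IsLeftCancelMul N] {f g : TriangularMonoid m n →* N}
    (h : ∀ i, f (w m n i) = g (w m n i)) : f = g := by
  have eqLocus_eq_top : f.eqLocusM g = ⊤ := by
    refine eq_top_of_w_mem m n h fun a b ha hab => ?_
    rw [MonoidHom.mem_eqLocusM, map_mul, map_mul, MonoidHom.mem_eqLocusM.1 ha] at hab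
    exact mul_left_cancel hab
  exact MonoidHom.ext fun a => (eqLocus_eq_top ▸ Submonoid.mem_top a : a ∈ f.eqLocusM g)

lemma exists_w_pow_eq (N : ℕ)
    (hN : ∀ i : Fin k, (∏ j ∈ Finset.Iic i, (m j + 1)) ∣ N * ∏ j ∈ Finset.Iio i, (n j + 1))
    (i : Fin (k + 1)) :
    ∃ K, w m n 0 ^ N = w m n i ^ K ∧
      K * ∏ j with j.castSucc < i, (m j + 1) = N * ∏ j with j.castSucc < i, (n j + 1) := by
  induction i using Fin.induction with
  | zero => exact ⟨N, rfl, by simp⟩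
  | succ j ih =>
    obtain ⟨K, hK, e⟩ := ih
    have filter_castSucc : (Finset.univ.filter fun i : Fin k => i.castSucc < j.castSucc)
        = Finset.Iio j := by ext; simp
    have filter_succ : (Finset.univ.filter fun i : Fin k => i.castSucc < j.succ)
        = Finset.Iic j := by ext; simp [Fin.castSucc_lt_succ_iff]
    have prod_pos : 0 < ∏ i ∈ Finset.Iio j, (m i + 1) :=
      Finset.prod_pos fun i _ => (m i).succ_pos
    rw [filter_castSucc] at e
    obtain ⟨c, rfl⟩ : m j + 1 ∣ K := by
      refine Nat.dvd_of_mul_dvd_mul_right prod_pos ?_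
      rw [e, Finset.mul_prod_Iio_eq_prod_Iic (f := fun i => m i + 1)]
      exact hN j
    refine ⟨(n j + 1) * c, by rw [hK, pow_mul, w_pow, pow_mul], ?_⟩
    rw [filter_succ, ← Finset.mul_prod_Iio_eq_prod_Iic, ← Finset.mul_prod_Iio_eq_prod_Iic]
    linear_combination (n j + 1) * e

lemma commute_of_zero_pow (N : ℕ)
    (hN : ∀ i : Fin k, (∏ j ∈ Finset.Iic i, (m j + 1)) ∣ N * ∏ j ∈ Finset.Iio i, (n j + 1))
    (g : TriangularMonoid m n) : Commute (.of (rels m n) 0 ^ N) g := by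
  have := (presents_mk m n).isLeftCancelMul
  rw [← w_zero]
  suffices h : Submonoid.centralizer {w m n 0 ^ N} = ⊤ by
    have hg : g ∈ Submonoid.centralizer {w m n 0 ^ N} := h ▸ Submonoid.mem_top g
    exact Submonoid.mem_centralizer_iff.1 hg _ rfl
  refine eq_top_of_w_mem m n (fun i => ?_) fun g h hg hgh => ?_
  · obtain ⟨K, hK, -⟩ := exists_w_pow_eq m n N hN i
    simp [Submonoid.mem_centralizer_iff, hK, (Commute.pow_self (w m n i) K).eq]
  · simp only [Submonoid.mem_centralizer_iff, Set.mem_singleton_iff, forall_eq] at hg hgh ⊢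
    refine mul_left_cancel (a := g) ?_
    rw [← mul_assoc, ← hg, mul_assoc, hgh, mul_assoc]

lemma prod_Iic_dvd (i : Fin k) : (∏ j ∈ Finset.Iic i, (m j + 1)) ∣
    (∏ j, (m j + 1)) * ∏ j ∈ Finset.Iio i, (n j + 1) :=
  (Finset.prod_dvd_prod_of_subset _ _ _ (Finset.subset_univ _)).mul_right _

theorem isOType : IsOType (TriangularMonoid m n) := by
  have hp : ∏ j, (m j + 1) ≠ 0 := Finset.prod_ne_zero_iff.2 fun j _ => (m j).succ_ne_zero
  exact (presents_mk m n).isOType (presents_mkOp m n)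
    (commute_of_zero_pow m n _ (prod_Iic_dvd m n))
    (fun i => ((presents_mk m n).of_dvd_of_zero i).trans (dvd_pow_self _ hp))
    (fun i => ((presents_mkOp m n).of_dvd_of_zero i).trans (dvd_pow_self _ hp))

end TriangularMonoid

/-! ### Left-orderings and monoids of O-type -/

namespace LeftOrdering

variable {G : Type*} [Group G]

lemma lt_iff (r : LeftOrdering G) (g h : G) : r.lt g h ↔ g⁻¹ * h ∈ r.positiveCone :=
  ⟨fun e => by simpa [positiveCone] using r.mul_left g⁻¹ _ _ e,
    fun e => by simpa using r.mul_left g _ _ e⟩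

lemma mul_mem_positiveCone (r : LeftOrdering G) {g h : G} (hg : g ∈ r.positiveCone)
    (hh : h ∈ r.positiveCone) : g * h ∈ r.positiveCone :=
  r.trans _ _ _ hg (by simpa using r.mul_left g _ _ hh)

lemma eq_of_lt_imp {r s : LeftOrdering G} (h : ∀ a b, r.lt a b → s.lt a b) : r = s := by
  ext a b
  refine ⟨h a b, fun hab => ?_⟩
  rcases r.total a b with h' | rfl | h'
  · exact h'
  · exact absurd hab (s.irrefl _)
  · exact absurd (s.trans _ _ _ hab (h _ _ h')) (s.irrefl _)

lemma eq_of_positiveCone_subset {r s : LeftOrdering G} (h : r.positiveCone ⊆ s.positiveCone) :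
    r = s :=
  eq_of_lt_imp fun a b hab => (s.lt_iff a b).2 (h ((r.lt_iff a b).1 hab))

lemma isOpen_setOf_lt (a b : G) : IsOpen {r : LeftOrdering G | r.lt a b} := by
  classical
  have continuous_decide : Continuous fun (r : LeftOrdering G) (p : G × G) =>
      @decide (r.lt p.1 p.2) (Classical.propDecidable _) := continuous_induced_dom
  convert ((continuous_apply (a, b)).comp continuous_decide).isOpen_preimage {true}
    (isOpen_discrete _) using 1
  ext r
  simp

theorem isIsolated_of_positiveCone_eq_closure (r : LeftOrdering G) {S : Set G} (hS : S.Finite)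
    (hr : r.positiveCone = Subsemigroup.closure S) : r.IsIsolated := by
  have singleton_eq : ({r} : Set (LeftOrdering G)) = ⋂ s ∈ S, {t | t.lt 1 s} := by
    ext t
    simp only [Set.mem_singleton_iff, Set.mem_iInter, Set.mem_ofPred_eq]
    refine ⟨?_, fun h => (eq_of_positiveCone_subset ?_).symm⟩
    · rintro rfl s hs
      exact (hr ▸ Subsemigroup.subset_closure hs : s ∈ t.positiveCone)
    · let P : Subsemigroup G := ⟨t.positiveCone, t.mul_mem_positiveCone⟩
      exact hr ▸ (Subsemigroup.closure_le.2 h : Subsemigroup.closure S ≤ P)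
  rw [IsIsolated, singleton_eq]
  exact hS.isOpen_biInter fun s _ => isOpen_setOf_lt 1 s

/-- The left-invariant ordering `g < h ↔ g⁻¹ * h ∈ P` with positive cone `P`. -/
def ofPositiveCone (P : Subsemigroup G) (one_notMem : 1 ∉ P)
    (mem_or_inv_mem : ∀ g, g ∈ P ∨ g = 1 ∨ g⁻¹ ∈ P) : LeftOrdering G where
  lt g h := g⁻¹ * h ∈ P
  irrefl g := by rwa [inv_mul_cancel]
  trans f g h hfg hgh := by simpa [mul_assoc] using P.mul_mem hfg hgh
  total g h := by simpa [inv_mul_eq_one] using mem_or_inv_mem (g⁻¹ * h)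
  mul_left h g g' hg := by simpa [mul_assoc] using hg

lemma positiveCone_ofPositiveCone (P : Subsemigroup G) (one_notMem : 1 ∉ P)
    (mem_or_inv_mem : ∀ g, g ∈ P ∨ g = 1 ∨ g⁻¹ ∈ P) :
    (ofPositiveCone P one_notMem mem_or_inv_mem).positiveCone = P := by
  ext g
  simp [positiveCone, ofPositiveCone]

end LeftOrdering

namespace IsOType

variable {M : Type*} [Monoid M]

lemma eq_one_of_mul_eq_one (hM : IsOType M) {g h : M} (e : g * h = 1) : g = 1 := by
  have e' : h * g = 1 := hM.left_cancel g _ _ (by rw [← mul_assoc, e, one_mul, mul_one])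
  exact hM.eq_one_of_isUnit g ⟨⟨g, h, e, e'⟩, rfl⟩

lemma mem_closure_iff_ne_one (hM : IsOType M) {S : Set M} (hS : Submonoid.closure S = ⊤)
    (one_notMem : 1 ∉ S) {g : M} : g ∈ Subsemigroup.closure S ↔ g ≠ 1 := by
  let P : Subsemigroup M :=
    { carrier := {g | g ≠ 1}
      mul_mem' := fun hg _ e => hg (hM.eq_one_of_mul_eq_one e) }
  have closure_le : Subsemigroup.closure S ≤ P :=
    Subsemigroup.closure_le.2 fun s hs e => one_notMem (e ▸ hs)
  refine ⟨fun hg => closure_le hg, fun hg => ?_⟩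
  have : g ∈ (Submonoid.closure S : Set M) := hS ▸ Submonoid.mem_top g
  rw [Submonoid.closure_eq_one_union] at this
  exact this.resolve_left hg

lemma exists_common_left_multiple (hM : IsOType M) (g h : M) : ∃ a b, b * g = a * h := by
  rcases hM.right_total g h with ⟨c, hc⟩ | ⟨c, hc⟩
  · exact ⟨1, c, by rw [hc, one_mul]⟩
  · exact ⟨c, 1, by rw [hc, one_mul]⟩

theorem exists_injective_hom_group.{u} {M : Type u} [Monoid M] (hM : IsOType M) :
    ∃ (H : Type u) (_ : Group H) (f : M →* H), Function.Injective f := by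
  choose num den hore using hM.exists_common_left_multiple
  let _ : OreLocalization.OreSet (⊤ : Submonoid M) :=
    { ore_right_cancel := fun _ _ s e => ⟨1, by rw [hM.right_cancel _ _ _ e]⟩
      oreNum := fun r s => num r s
      oreDenom := fun r s => ⟨den r s, trivial⟩
      ore_eq := fun r s => hore r s }
  let f : M →* OreLocalization (⊤ : Submonoid M) M := OreLocalization.numeratorHom
  have isUnit_map (g : M) : IsUnit (f g) :=
    OreLocalization.numerator_isUnit (⟨g, trivial⟩ : (⊤ : Submonoid M))
  refine ⟨_, inferInstance, IsUnit.liftRight f isUnit_map, fun g h e => ?_⟩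
  have map_eq : f g = f h := congrArg Units.val e
  obtain ⟨a, b, hab, hab'⟩ := OreLocalization.oreDiv_eq_iff.1 map_eq
  obtain rfl : (a : M) = b := by simpa using hab'
  exact (hM.left_cancel _ _ _ hab).symm

variable {G : Type*} [Group G] {f : M →* G}

lemma mem_range_or_inv_mem_range (hM : IsOType M) (hf : Subgroup.closure (Set.range f) = ⊤)
    (g : G) : g ∈ Set.range f ∨ g⁻¹ ∈ Set.range f := by
  have mul_inv_mem (a b : M) : f a * (f b)⁻¹ ∈ Set.range f ∨ (f a * (f b)⁻¹)⁻¹ ∈ Set.range f := by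
    rcases hM.right_total a b with ⟨c, rfl⟩ | ⟨c, rfl⟩
    · exact .inr ⟨c, by simp⟩
    · exact .inl ⟨c, by simp⟩
  have inv_mul_mem (a b : M) : (f a)⁻¹ * f b ∈ Set.range f ∨ ((f a)⁻¹ * f b)⁻¹ ∈ Set.range f := by
    rcases hM.left_total a b with ⟨c, rfl⟩ | ⟨c, rfl⟩
    · exact .inl ⟨c, by simp⟩
    · exact .inr ⟨c, by simp⟩
  have hg : g ∈ Subgroup.closure (Set.range f) := hf ▸ Subgroup.mem_top g
  induction hg using Subgroup.closure_induction with
  | mem x hx => exact .inl hx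
  | one => exact .inl ⟨1, map_one f⟩
  | inv x _ ih => rwa [inv_inv, or_comm]
  | mul x y _ _ ihx ihy =>
    rcases ihx with ⟨a, ha⟩ | ⟨a, ha⟩ <;> rcases ihy with ⟨b, hb⟩ | ⟨b, hb⟩
    · exact .inl ⟨a * b, by rw [map_mul, ha, hb]⟩
    · simpa [ha, hb] using mul_inv_mem a b
    · simpa [ha, hb] using inv_mul_mem a b
    · exact .inr ⟨b * a, by rw [map_mul, ha, hb, mul_inv_rev]⟩

theorem exists_positiveCone_eq_closure (hM : IsOType M) (f_injective : Function.Injective f)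
    (hf : Subgroup.closure (Set.range f) = ⊤) {S : Set M} (hS : Submonoid.closure S = ⊤)
    (one_notMem : 1 ∉ S) :
    ∃ r : LeftOrdering G, r.positiveCone = Subsemigroup.closure (f '' S) := by
  have map_mem (g : M) : f g ∈ Subsemigroup.closure (f '' S) ↔ g ≠ 1 := by
    rw [← hM.mem_closure_iff_ne_one hS one_notMem]
    exact MulHom.map_mclosure (f : M →ₙ* G) S ▸ Subsemigroup.mem_map_iff_mem f_injective
  refine ⟨.ofPositiveCone _ ?_ fun g => ?_, LeftOrdering.positiveCone_ofPositiveCone _ _ _⟩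
  · rw [← map_one f, map_mem]
    exact not_not_intro rfl
  · by_cases hg : g = 1
    · exact .inr (.inl hg)
    rcases hM.mem_range_or_inv_mem_range hf g with ⟨a, rfl⟩ | ⟨a, ha⟩
    · exact .inl ((map_mem a).2 fun e => hg (by rw [e, map_one]))
    · refine .inr (.inr (ha ▸ (map_mem a).2 fun e => hg ?_))
      rwa [e, map_one, eq_comm, inv_eq_one] at ha

end IsOType

/-! ### The group -/

namespace TorusAmalgam

open FreeMonoid TriangularMonoid

variable {k : ℕ} (m n : Fin k → ℕ)

lemma x_pow (j : Fin k) : x m n j.castSucc ^ (m j + 1) = x m n j.succ ^ (n j + 1) := by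
  have h := PresentedGroup.one_of_mem (rels := Set.range fun j : Fin k =>
    FreeGroup.of j.castSucc ^ (m j + 1) * (FreeGroup.of j.succ ^ (n j + 1))⁻¹) ⟨j, rfl⟩
  rw [map_mul, map_inv, map_pow, map_pow] at h
  exact mul_inv_eq_one.1 h

lemma lift_word_of_lift_wordPrefix {i : Fin (k + 1)} (h : FreeMonoid.lift (coneGen m n)
      (wordPrefix m i) = (Fin.partialProd (fun j : Fin k => (x m n j.castSucc ^ m j)⁻¹) i)⁻¹) :
    FreeMonoid.lift (coneGen m n) (word m i) = x m n i := by
  rw [word, map_mul, h, FreeMonoid.lift_eval_of, coneGen, inv_mul_cancel_left]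

lemma lift_wordPrefix (i : Fin (k + 1)) : FreeMonoid.lift (coneGen m n) (wordPrefix m i)
    = (Fin.partialProd (fun j : Fin k => (x m n j.castSucc ^ m j)⁻¹) i)⁻¹ := by
  induction i using Fin.induction with
  | zero => simp [wordPrefix_zero]
  | succ j ih =>
    rw [wordPrefix_succ, map_mul, map_pow, lift_word_of_lift_wordPrefix m n ih, ih,
      Fin.partialProd_succ, mul_inv_rev, inv_inv]

lemma lift_word (i : Fin (k + 1)) : FreeMonoid.lift (coneGen m n) (word m i) = x m n i :=
  lift_word_of_lift_wordPrefix m n (lift_wordPrefix m n i)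

/-- The homomorphism from the monoid to the group that maps `a_i` to `coneGen i`, and hence `w_i`
to `x_i`. -/
def ofMonoid : TriangularMonoid m n →* TorusAmalgam m n :=
  PresentedMonoid.lift (coneGen m n) <| by
    rintro _ _ ⟨j, rfl, rfl⟩
    rw [map_mul, map_pow, lift_word, FreeMonoid.lift_eval_of, FreeMonoid.lift_eval_of, coneGen,
      coneGen, Fin.partialProd_succ, mul_assoc, mul_assoc, ← pow_succ', ← x_pow, pow_succ,
      inv_mul_cancel_left]

lemma ofMonoid_w (i : Fin (k + 1)) : ofMonoid m n (w m n i) = x m n i := lift_word m n i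

lemma closure_range_ofMonoid : Subgroup.closure (Set.range (ofMonoid m n)) = ⊤ := by
  rw [eq_top_iff, ← PresentedGroup.closure_range_of]
  exact Subgroup.closure_mono (Set.range_subset_iff.2 fun i => ⟨w m n i, ofMonoid_w m n i⟩)

lemma ofMonoid_injective : Function.Injective (ofMonoid m n) := by
  obtain ⟨H, _, f, f_injective⟩ := (isOType m n).exists_injective_hom_group
  let F : TorusAmalgam m n →* H := PresentedGroup.toGroup (f := fun i => f (w m n i)) <| by
    rintro _ ⟨j, rfl⟩
    rw [map_mul, map_inv, map_pow, map_pow, FreeGroup.lift_apply_of, FreeGroup.lift_apply_of,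
      ← map_pow, ← map_pow, w_pow, mul_inv_cancel]
  have comp_ofMonoid : F.comp (ofMonoid m n) = f := hom_ext_w m n fun i => by
    rw [MonoidHom.comp_apply, ofMonoid_w]
    exact PresentedGroup.toGroup.of _
  exact .of_comp (f := F) (by rwa [← MonoidHom.coe_comp, comp_ofMonoid])

theorem exists_positiveCone_eq_closure_coneGen : ∃ r : LeftOrdering (TorusAmalgam m n),
    r.positiveCone = Subsemigroup.closure (Set.range (coneGen m n)) := by
  have one_notMem : (1 : TriangularMonoid m n) ∉ Set.range (PresentedMonoid.of (rels m n)) := by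
    rintro ⟨i, hi⟩
    exact FreeMonoid.of_ne_one i ((presents_mk m n).map_eq_one_iff.1 hi)
  have image_range : ofMonoid m n '' Set.range (PresentedMonoid.of (rels m n))
      = Set.range (coneGen m n) := (Set.range_comp _ _).symm
  exact image_range ▸ (isOType m n).exists_positiveCone_eq_closure (ofMonoid_injective m n)
    (closure_range_ofMonoid m n) (PresentedMonoid.closure_range_of _) one_notMem

end TorusAmalgam

theorem corollary8p5 (k : ℕ) (hk : 1 ≤ k) (m n : Fin k → ℕ)
    (hm : ∀ j, 1 ≤ m j) (hn : ∀ j, 1 ≤ n j) :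
    -- the triangular monoid is of O-type
    IsOType (TriangularMonoid m n) ∧
    -- explicit central powers of the first generator
    (∀ N : ℕ,
      (∀ i : Fin k, (∏ j ∈ Finset.Iic i, (m j + 1)) ∣ N * ∏ j ∈ Finset.Iio i, (n j + 1)) →
      ∀ g : TriangularMonoid m n,
        PresentedMonoid.of (TriangularMonoid.rels m n) 0 ^ N * g
          = g * PresentedMonoid.of (TriangularMonoid.rels m n) 0 ^ N) ∧
    (∀ g : TriangularMonoid m n,
      PresentedMonoid.of (TriangularMonoid.rels m n) 0 ^ (∏ j, (m j + 1)) * g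
        = g * PresentedMonoid.of (TriangularMonoid.rels m n) 0 ^ (∏ j, (m j + 1))) ∧
    -- the group is left-orderable
    Nonempty (LeftOrdering (TorusAmalgam m n)) ∧
    -- it has an isolated left-ordering with the given positive cone
    ∃ r : LeftOrdering (TorusAmalgam m n),
      r.positiveCone = (Subsemigroup.closure (Set.range (TorusAmalgam.coneGen m n)) :
        Set (TorusAmalgam m n)) ∧
      r.IsIsolated := by
  obtain ⟨r, hr⟩ := TorusAmalgam.exists_positiveCone_eq_closure_coneGen m n
  exact ⟨TriangularMonoid.isOType m n, TriangularMonoid.commute_of_zero_pow m n,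
    TriangularMonoid.commute_of_zero_pow m n _ (TriangularMonoid.prod_Iic_dvd m n), ⟨r⟩,
    r, hr, r.isIsolated_of_positiveCone_eq_closure (Set.finite_range _) hr⟩
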